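/- Let $R$ be a commutative noetherian ring with identity, $S$ a commutative ring, and $C$ a semidualizing $R$-module, i.e. a finitely generated $R$-module with $R\cong\operatorname{Hom}_R(C,C)$ and $\operatorname{Ext}^i_R(C,C)=0$ for all $i\ge 1$. Let $f\colon R\to S$ and $g\colon S\to R$ be ring homomorphisms with $g\circ f=\mathrm{id}_R$, regard $S$ as an $R$-module via $f$, and assume that 1. $\operatorname{Hom}_R(S,C)\cong S$ as $S$-modules, 2. $\operatorname{Ext}^i_R(S,C)=0$ for all $i\ge 1$, and 3. $C\cong\ker g$ as $R$-modules. Then an $R$-module $M$ is $C$-Gorenstein projective over $R$ if and only if $M$, regarded as an $S$-module via $g$, is Gorenstein projective over $S$. Here $M$ is called $C$-Gorenstein projective over $R$ if there is an exact sequence of $R$-modules $$X=\cdots\to X_1\xrightarrow{\partial_1}X_0\xrightarrow{\partial_0}X_{-1}\xrightarrow{\partial_{-1}}X_{-2}\to\cdots$$ such that $X_i$ is projective for $i\ge 0$, $X_j$ is isomorphic to $C\otimes_R P_j$ for some projective $R$-module $P_j$ for each $j\le -1$, the complex $\operatorname{Hom}_R(X,C\otimes_R P)$ is exact for every projective $R$-module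 $P$, and $\operatorname{Coker}\partial_1\cong M$. An $S$-module $N$ is Gorenstein projective over $S$ if there is an exact sequence $X$ of projective $S$-modules such that $\operatorname{Hom}_S(X,P)$ is exact for every projective $S$-module $P$ and $\operatorname{Coker}\partial_1\cong N$. -/

import Mathlib

open CategoryTheory TensorProduct

universe u

/-- A finitely generated module `C` over a commutative ring `R` is semidualizing if
`R ≅ Hom_R(C, C)` and `Ext_R^i(C, C) = 0` for all `i ≥ 1`. -/
structure IsSemidualizing (R : Type u) [CommRing R] (C : Type u) [AddCommGroup C] [Module R C] :
    Prop where
  finite : Module.Finite R C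
  end_equiv : Nonempty (R ≃ₗ[R] (C →ₗ[R] C))
  ext_vanishing : ∀ i : ℕ, 1 ≤ i →
    Subsingleton (Abelian.Ext (ModuleCat.of R C) (ModuleCat.of R C) i)

/-- The condition on a triple `(R, S, C)`, for the retract diagram formed by the structure map
`f = algebraMap R S` and a ring homomorphism `g : S → R`. -/
structure IsRetractTriple (R S : Type u) [CommRing R] [CommRing S] [Algebra R S]
    (g : S →+* R) (C : Type u) [AddCommGroup C] [Module R C] : Prop where
  /-- The retract diagram commutes: `g ∘ f = id_R`. -/
  retract : g.comp (algebraMap R S) = RingHom.id R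
  /-- `S ≅ Hom_R(S, C)` as `S`-modules, where `S` acts on `Hom_R(S, C)` by
  `(s • φ) u = φ (s * u)`; the displayed equation says `e (s • t) = s • e t`. -/
  hom_equiv : ∃ e : S ≃+ (S →ₗ[R] C), ∀ s t u : S, e (s * t) u = e t (s * u)
  /-- `Ext_R^i(S, C) = 0` for all `i ≥ 1`. -/
  ext_vanishing : ∀ i : ℕ, 1 ≤ i →
    Subsingleton (Abelian.Ext (ModuleCat.of R S) (ModuleCat.of R C) i)
  /-- `C ≅ ker g` as `R`-modules. -/
  ker_equiv : Nonempty (C ≃ₗ[R] RingHom.ker g)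

/-- The class of projective `R`-modules. -/
def projectiveClass (R : Type u) [CommRing R] : ModuleCat.{u} R → Prop :=
  fun N => Module.Projective R N

/-- The class of `R`-modules isomorphic to `C ⊗_R P` for some projective `R`-module `P`. -/
def tensorProjectiveClass (R : Type u) [CommRing R] (C : Type u) [AddCommGroup C] [Module R C] :
    ModuleCat.{u} R → Prop :=
  fun N => ∃ P : ModuleCat.{u} R, Module.Projective R P ∧ Nonempty (N ≃ₗ[R] C ⊗[R] P)

/-- For a class `𝒬` of `R`-modules: an exact sequence
`⋯ → X 1 → X 0 → X (-1) → X (-2) → ⋯` with `X i` projective for `i ≥ 0` and `X i` in `𝒬` for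
`i ≤ -1`, which stays exact under `Hom_R(-, A)` for every `A` in `𝒬`.
The differential out of degree `i + 1` is `d i`. -/
structure CompleteResolution (R : Type u) [CommRing R] (𝒬 : ModuleCat.{u} R → Prop) where
  X : ℤ → ModuleCat.{u} R
  d : ∀ i : ℤ, X (i + 1) →ₗ[R] X i
  exact : ∀ i : ℤ, Function.Exact (d (i + 1)) (d i)
  projective : ∀ i : ℤ, 0 ≤ i → Module.Projective R (X i)
  mem : ∀ i : ℤ, i ≤ -1 → 𝒬 (X i)
  hom_exact : ∀ A : ModuleCat.{u} R, 𝒬 A → ∀ i : ℤ,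
    Function.Exact ((d i).lcomp R A) ((d (i + 1)).lcomp R A)

/-- The cokernel of the differential `X 1 → X 0`. -/
abbrev CompleteResolution.coker {R : Type u} [CommRing R] {𝒬 : ModuleCat.{u} R → Prop}
    (X : CompleteResolution R 𝒬) : Type u :=
  X.X 0 ⧸ LinearMap.range (X.d 0)

/-- `M` is `C`-Gorenstein projective: it is the cokernel of `X 1 → X 0` for a complete
resolution by projective modules on the left and modules `C ⊗_R P` on the right. -/
def IsCGorensteinProjective (R : Type u) [CommRing R] (C : Type u) [AddCommGroup C] [Module R C]
    (M : Type u) [AddCommGroup M] [Module R M] : Prop :=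
  ∃ X : CompleteResolution R (tensorProjectiveClass R C), Nonempty (X.coker ≃ₗ[R] M)

/-- `M` is Gorenstein projective: it is the cokernel of `X 1 → X 0` for a complete projective
resolution `X`. -/
def IsGorensteinProjective (R : Type u) [CommRing R]
    (M : Type u) [AddCommGroup M] [Module R M] : Prop :=
  ∃ X : CompleteResolution R (projectiveClass R), Nonempty (X.coker ≃ₗ[R] M)

/-!
For an `S`-module `N`, being Gorenstein projective over `S` is the same as being `C`-Gorenstein
projective over `R` (`IsRetractTriple.isCGorensteinProjective_iff`). The theorem is the case of an
`R`-module viewed as an `S`-module via `g`, whose restriction along `R → S` is the module itself.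

The isomorphism `S ≅ Hom_R(S, C)` amounts to a Frobenius form: an `R`-linear `ε : S → C` such that
composition with `ε` identifies `Hom_S(N, S^(ι))` with `Hom_R(N, C^(ι))` for every `S`-module `N`.
By dimension shifting, `Ext_S^i(N, S^(ι))` and `Ext_R^i(N, C^(ι))` vanish together. The
isomorphism `C ≅ ker g` shows that `ε` is onto with kernel `R`.

Relative Gorenstein projectivity is used in a coinductive form (`IsSumGProjective`): `M` lies in
some class of modules orthogonal to all `C^(ι)`, each member of which embeds into some `C^(ι)` with
cokernel in the class. With `C = S` this also covers Gorenstein projective `S`-modules. These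
modules are closed under extensions and direct powers `M^(ι)`. Over `R` they include `R` itself,
because the duals `Hom(K, C)` of totally `C`-reflexive modules `K` form such a class and
`R ≅ Hom(C, C)`; hence they include `S`, an extension of `C` by `R`.

If `N` is `C`-Gorenstein projective over `R`, lift an embedding `N → C^(ι)` with cokernel `L` to an
`S`-linear embedding `N → S^(ι)`. Over `R` its cokernel is an extension of `L` by
`(ker ε)^(ι) ≅ R^(ι)`, so it is `C`-Gorenstein projective again, and the construction iterates.
Conversely, a coresolution of `N` by free `S`-modules is over `R` a coresolution by `C`-Gorenstein
projective modules with orthogonal cosyzygies, and such a coresolution can be replaced by one by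
modules `C^(κ)` (`IsSumGProjective.of_coresolution`).
-/

/-! ### Short exact sequences and vanishing of `Ext` -/

/-- The pair of linear maps `f`, `g` forms a short exact sequence `0 → A → B → D → 0`. -/
structure IsShortExact {R : Type*} [CommRing R] {A B D : Type*} [AddCommGroup A] [Module R A]
    [AddCommGroup B] [Module R B] [AddCommGroup D] [Module R D]
    (f : A →ₗ[R] B) (g : B →ₗ[R] D) : Prop where
  injective : Function.Injective f
  exact : Function.Exact f g
  surjective : Function.Surjective g

/-- `Ext_R^n(M, A) = 0`. -/
def ExtVanishes (R : Type u) [CommRing R] (n : ℕ) (M A : Type u) [AddCommGroup M] [Module R M]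
    [AddCommGroup A] [Module R A] : Prop :=
  Subsingleton (Abelian.Ext (ModuleCat.of R M) (ModuleCat.of R A) n)

/-- `Ext_R^i(M, A) = 0` for all `i ≥ 1`. -/
def ExtOrthogonal (R : Type u) [CommRing R] (M A : Type u) [AddCommGroup M] [Module R M]
    [AddCommGroup A] [Module R A] : Prop :=
  ∀ i : ℕ, 1 ≤ i → ExtVanishes R i M A

namespace IsShortExact

section Basic

variable {R : Type*} [CommRing R] {A B D : Type*} [AddCommGroup A] [Module R A]
  [AddCommGroup B] [Module R B] [AddCommGroup D] [Module R D]

lemma comp_eq_zero {f : A →ₗ[R] B} {g : B →ₗ[R] D} (h : IsShortExact f g) : g ∘ₗ f = 0 :=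
  h.exact.linearMap_comp_eq_zero

lemma mkQ {f : A →ₗ[R] B} (hf : Function.Injective f) :
    IsShortExact f (LinearMap.range f).mkQ :=
  ⟨hf, LinearMap.exact_map_mkQ_range f, Submodule.mkQ_surjective _⟩

lemma subtype {g : B →ₗ[R] D} (hg : Function.Surjective g) :
    IsShortExact (LinearMap.ker g).subtype g :=
  ⟨Submodule.subtype_injective _, LinearMap.exact_subtype_ker_map g, hg⟩

/-- A linear map vanishing on the first term of a short exact sequence factors through the
third. -/
lemma exists_factor {f : A →ₗ[R] B} {g : B →ₗ[R] D} (h : IsShortExact f g)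
    {E : Type*} [AddCommGroup E] [Module R E] (φ : B →ₗ[R] E) (hφ : ∀ a, φ (f a) = 0) :
    ∃ ψ : D →ₗ[R] E, ∀ b, ψ (g b) = φ b := by
  have hk : LinearMap.ker g ≤ LinearMap.ker φ := by
    intro b hb
    obtain ⟨a, rfl⟩ := (h.exact b).1 hb
    exact hφ a
  refine ⟨(LinearMap.ker g).liftQ φ hk ∘ₗ (g.quotKerEquivOfSurjective h.surjective).symm, ?_⟩
  intro b
  have : (g.quotKerEquivOfSurjective h.surjective).symm (g b) = (LinearMap.ker g).mkQ b := by
    rw [LinearEquiv.symm_apply_eq]; rfl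
  simp [this]

lemma inl_snd : IsShortExact (LinearMap.inl R A B) (LinearMap.snd R A B) :=
  ⟨LinearMap.inl_injective, .inl_snd, LinearMap.snd_surjective⟩

lemma finsupp {f : A →ₗ[R] B} {g : B →ₗ[R] D} (h : IsShortExact f g) (ι : Type*) :
    IsShortExact (Finsupp.mapRange.linearMap (α := ι) f) (Finsupp.mapRange.linearMap g) := by
  refine ⟨Finsupp.mapRange_injective f (map_zero f) h.injective, ?_,
    Finsupp.mapRange_surjective g (map_zero g) h.surjective⟩
  intro x
  constructor
  · intro hx
    have hx' : ∀ i, ∃ a, f a = x i := fun i => (h.exact _).1 (by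
      simpa using DFunLike.congr_fun hx i)
    choose a ha using hx'
    refine ⟨Finsupp.onFinset x.support a fun i hi => ?_, ?_⟩
    · rw [Finsupp.mem_support_iff, ← ha]
      exact fun h0 => hi (h.injective (by simpa using h0))
    · ext i
      simp [ha]
  · rintro ⟨y, rfl⟩
    ext i
    simpa using h.exact.apply_apply_eq_zero (y i)

/-- Restriction of scalars to `R` preserves short exact sequences. -/
lemma restrictScalars {S : Type*} [CommRing S] [Algebra R S] [Module S A] [Module S B]
    [Module S D] [IsScalarTower R S A] [IsScalarTower R S B] [IsScalarTower R S D]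
    {f : A →ₗ[S] B} {g : B →ₗ[S] D} (h : IsShortExact f g) :
    IsShortExact (f.restrictScalars R) (g.restrictScalars R) :=
  ⟨h.injective, h.exact, h.surjective⟩

end Basic

variable {R : Type u} [CommRing R] {A B D : Type u} [AddCommGroup A] [Module R A]
  [AddCommGroup B] [Module R B] [AddCommGroup D] [Module R D]
  {f : A →ₗ[R] B} {g : B →ₗ[R] D} {T : Type u} [AddCommGroup T] [Module R T]

lemma shortExact (h : IsShortExact f g) :
    (ShortComplex.mk (ModuleCat.ofHom f) (ModuleCat.ofHom g)
      (by rw [← ModuleCat.ofHom_comp, h.comp_eq_zero]; rfl)).ShortExact where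
  exact := by
    rw [CategoryTheory.ShortComplex.ShortExact.moduleCat_exact_iff_function_exact]
    exact h.exact
  mono_f := (ModuleCat.mono_iff_injective _).2 h.injective
  epi_g := (ModuleCat.epi_iff_surjective _).2 h.surjective

lemma extVanishes_middle (h : IsShortExact f g) {n : ℕ} (hA : ExtVanishes R n A T)
    (hD : ExtVanishes R n D T) : ExtVanishes R n B T := by
  refine subsingleton_of_forall_eq 0 fun x => ?_
  obtain ⟨y, rfl⟩ := Abelian.Ext.contravariant_sequence_exact₂ h.shortExact _ x
    (hA.elim _ _)
  rw [hD.elim y 0, Abelian.Ext.comp_zero]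

lemma extVanishes_left (h : IsShortExact f g) {n : ℕ} (hB : ExtVanishes R n B T)
    (hD : ExtVanishes R (n + 1) D T) : ExtVanishes R n A T := by
  refine subsingleton_of_forall_eq 0 fun x => ?_
  obtain ⟨y, rfl⟩ := Abelian.Ext.contravariant_sequence_exact₁ h.shortExact _ x
    (add_comm 1 n) (hD.elim _ _)
  rw [hB.elim y 0, Abelian.Ext.comp_zero]

lemma extVanishes_right (h : IsShortExact f g) {n : ℕ} (hA : ExtVanishes R n A T)
    (hB : ExtVanishes R (n + 1) B T) : ExtVanishes R (n + 1) D T := by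
  refine subsingleton_of_forall_eq 0 fun x => ?_
  obtain ⟨y, rfl⟩ := Abelian.Ext.contravariant_sequence_exact₃ h.shortExact _ x
    (hB.elim _ _) (add_comm 1 n)
  rw [hA.elim y 0, Abelian.Ext.comp_zero]

/-- If `Ext^1(D, T) = 0`, then linear maps to `T` extend along `A → B`. -/
lemma exists_extend (h : IsShortExact f g) (hD : ExtVanishes R 1 D T) (φ : A →ₗ[R] T) :
    ∃ ψ : B →ₗ[R] T, ∀ a, ψ (f a) = φ a := by
  obtain ⟨y, hy⟩ := Abelian.Ext.contravariant_sequence_exact₁ h.shortExact _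
    (Abelian.Ext.mk₀ (ModuleCat.ofHom φ)) (add_comm 1 0) (hD.elim _ _)
  obtain ⟨ψ, rfl⟩ := (Abelian.Ext.mk₀_bijective _ _).2 y
  rw [Abelian.Ext.mk₀_comp_mk₀] at hy
  have := (Abelian.Ext.mk₀_bijective _ _).1 hy
  refine ⟨ψ.hom, fun a => ?_⟩
  exact LinearMap.congr_fun (congrArg ModuleCat.Hom.hom this) a

lemma extVanishes_one_right (h : IsShortExact f g) (hB : ExtVanishes R 1 B T)
    (he : ∀ φ : A →ₗ[R] T, ∃ ψ : B →ₗ[R] T, ∀ a, ψ (f a) = φ a) : ExtVanishes R 1 D T := by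
  refine subsingleton_of_forall_eq 0 fun x => ?_
  obtain ⟨y, rfl⟩ := Abelian.Ext.contravariant_sequence_exact₃ h.shortExact _ x
    (hB.elim _ _) (add_comm 1 0)
  obtain ⟨φ, rfl⟩ := (Abelian.Ext.mk₀_bijective _ _).2 y
  obtain ⟨ψ, hψ⟩ := he φ.hom
  have : φ = ModuleCat.ofHom f ≫ ModuleCat.ofHom ψ := by
    ext a
    exact (hψ a).symm
  rw [this, ← Abelian.Ext.mk₀_comp_mk₀]
  exact h.shortExact.extClass_comp_assoc _

lemma extOrthogonal_middle (h : IsShortExact f g) (hA : ExtOrthogonal R A T)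
    (hD : ExtOrthogonal R D T) : ExtOrthogonal R B T :=
  fun i hi => h.extVanishes_middle (hA i hi) (hD i hi)

lemma extOrthogonal_right (h : IsShortExact f g) (hA : ExtOrthogonal R A T)
    (hB : ExtOrthogonal R B T)
    (he : ∀ φ : A →ₗ[R] T, ∃ ψ : B →ₗ[R] T, ∀ a, ψ (f a) = φ a) : ExtOrthogonal R D T := by
  intro i hi
  obtain ⟨n, rfl⟩ := Nat.exists_eq_add_of_le' hi
  rcases n with _ | n
  · exact h.extVanishes_one_right (hB 1 le_rfl) he
  · exact h.extVanishes_right (hA _ (by lia)) (hB _ (by lia))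

end IsShortExact

section Retract

variable {R : Type u} [CommRing R] {M N A B : Type u} [AddCommGroup A] [Module R A]
  [AddCommGroup B] [Module R B] [AddCommGroup M] [Module R M] [AddCommGroup N] [Module R N]

lemma ExtVanishes.of_retract_left {n : ℕ} (h : ExtVanishes R n M A) (i : N →ₗ[R] M)
    (p : M →ₗ[R] N) (hpi : ∀ x, p (i x) = x) : ExtVanishes R n N A := by
  refine subsingleton_of_forall_eq 0 fun x => ?_
  have : ModuleCat.ofHom i ≫ ModuleCat.ofHom p = 𝟙 (ModuleCat.of R N) := by
    ext a
    exact hpi a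
  rw [← Abelian.Ext.mk₀_id_comp x, ← this, ← Abelian.Ext.mk₀_comp_mk₀_assoc,
    h.elim ((Abelian.Ext.mk₀ (ModuleCat.ofHom p)).comp x (zero_add n)) 0, Abelian.Ext.comp_zero]

lemma ExtVanishes.of_retract_right {n : ℕ} (h : ExtVanishes R n M B) (i : A →ₗ[R] B)
    (p : B →ₗ[R] A) (hpi : ∀ x, p (i x) = x) : ExtVanishes R n M A := by
  refine subsingleton_of_forall_eq 0 fun x => ?_
  have : ModuleCat.ofHom i ≫ ModuleCat.ofHom p = 𝟙 (ModuleCat.of R A) := by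
    ext a
    exact hpi a
  have h0 : (x.comp (Abelian.Ext.mk₀ (ModuleCat.ofHom i)) (add_zero n)) = 0 := h.elim _ _
  rw [← Abelian.Ext.comp_mk₀_id x, ← this, ← Abelian.Ext.mk₀_comp_mk₀,
    ← Abelian.Ext.comp_assoc_of_third_deg_zero, h0, Abelian.Ext.zero_comp]

lemma ExtOrthogonal.of_retract_left (h : ExtOrthogonal R M A) (i : N →ₗ[R] M)
    (p : M →ₗ[R] N) (hpi : ∀ x, p (i x) = x) : ExtOrthogonal R N A :=
  fun n hn => (h n hn).of_retract_left i p hpi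

lemma ExtOrthogonal.of_retract_right (h : ExtOrthogonal R M B) (i : A →ₗ[R] B)
    (p : B →ₗ[R] A) (hpi : ∀ x, p (i x) = x) : ExtOrthogonal R M A :=
  fun n hn => (h n hn).of_retract_right i p hpi

lemma ExtOrthogonal.of_equiv_left (h : ExtOrthogonal R M A) (e : N ≃ₗ[R] M) :
    ExtOrthogonal R N A :=
  h.of_retract_left e.toLinearMap e.symm.toLinearMap (by simp)

lemma ExtOrthogonal.of_projective [Module.Projective R M] : ExtOrthogonal R M A := by
  intro i hi
  obtain ⟨n, rfl⟩ := Nat.exists_eq_add_of_le' hi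
  have : Projective (ModuleCat.of R M) := (IsProjective.iff_projective M).1 inferInstance
  exact Abelian.Ext.subsingleton_of_projective _ _ n

end Retract

section Finsupp

variable {R : Type u} [CommRing R]

lemma ExtVanishes.finsupp_left {A : Type u} [AddCommGroup A] [Module R A] (ι : Type u) (n : ℕ) :
    ∀ (M : Type u) [AddCommGroup M] [Module R M], ExtVanishes R (n + 1) M A →
      ExtVanishes R (n + 1) (ι →₀ M) A := by
  induction n with
  | zero =>
    intro M _ _ hM
    have hs := IsShortExact.subtype (Finsupp.linearCombination_id_surjective R M)
    refine (hs.finsupp ι).extVanishes_one_right (ExtOrthogonal.of_projective 1 le_rfl) ?_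
    intro φ
    choose ψ hψ using fun i : ι => hs.exists_extend hM (φ ∘ₗ Finsupp.lsingle i)
    refine ⟨Finsupp.lsum ℕ ψ, fun a => ?_⟩
    induction a using Finsupp.induction_linear with
    | zero => simp
    | add x y hx hy => rw [map_add, map_add, hx, hy, map_add]
    | single i x =>
      have := hψ i x
      simpa using this
  | succ n ih =>
    intro M _ _ hM
    have hs := IsShortExact.subtype (Finsupp.linearCombination_id_surjective R M)
    exact (hs.finsupp ι).extVanishes_right
      (ih _ (hs.extVanishes_left (ExtOrthogonal.of_projective _ (by lia)) hM))
      (ExtOrthogonal.of_projective _ (by lia))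

lemma ExtOrthogonal.finsupp_left {M A : Type u} [AddCommGroup M] [Module R M] [AddCommGroup A]
    [Module R A] (h : ExtOrthogonal R M A) (ι : Type u) : ExtOrthogonal R (ι →₀ M) A := by
  intro i hi
  obtain ⟨n, rfl⟩ := Nat.exists_eq_add_of_le' hi
  exact ExtVanishes.finsupp_left ι n M (h _ hi)

/-- A linear map from a finitely generated module to a direct sum lands in a finite
subsum. -/
lemma exists_finset_support {M A ι : Type*} [AddCommGroup M] [Module R M] [AddCommGroup A]
    [Module R A] [Module.Finite R M] (φ : M →ₗ[R] ι →₀ A) :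
    ∃ s : Finset ι, ∀ x i, φ x i ≠ 0 → i ∈ s := by
  classical
  obtain ⟨t, ht⟩ := Module.Finite.fg_top (R := R) (M := M)
  refine ⟨t.biUnion fun x => (φ x).support, fun x i hx => ?_⟩
  by_contra hi
  have : (⊤ : Submodule R M) ≤ LinearMap.ker (Finsupp.lapply i ∘ₗ φ) := by
    rw [← ht, Submodule.span_le]
    intro y hy
    by_contra hne
    exact hi (Finset.mem_biUnion.2 ⟨y, hy, Finsupp.mem_support_iff.2 hne⟩)
  exact hx (this (Submodule.mem_top (x := x)))

/-- Dimension shifting along `0 → L → Rⁿ → M → 0`: over a noetherian ring `L` is again finitely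
generated, and for `Ext^1` a map `L → A^(ι)` lands in a finite subsum, so that it can be extended to
`Rⁿ` componentwise. -/
lemma ExtVanishes.finsupp_right [IsNoetherianRing R] {A : Type u} [AddCommGroup A] [Module R A]
    (ι : Type u) (n : ℕ) :
    ∀ (M : Type u) [AddCommGroup M] [Module R M] [Module.Finite R M], ExtVanishes R (n + 1) M A →
      ExtVanishes R (n + 1) M (ι →₀ A) := by
  induction n with
  | zero =>
    intro M _ _ _ hM
    obtain ⟨k, p, hp⟩ := Module.Finite.exists_fin' R M
    have hs := IsShortExact.subtype hp
    refine hs.extVanishes_one_right (ExtOrthogonal.of_projective 1 le_rfl) ?_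
    intro φ
    obtain ⟨s, hs'⟩ := exists_finset_support φ
    choose ψ hψ using fun i : ι => hs.exists_extend hM (Finsupp.lapply i ∘ₗ φ)
    refine ⟨∑ i ∈ s, Finsupp.lsingle i ∘ₗ ψ i, fun a => ?_⟩
    have h1 : ∀ i, ψ i ((LinearMap.ker p).subtype a) = φ a i := fun i => hψ i a
    ext j
    rw [LinearMap.sum_apply, Finsupp.finsetSum_apply]
    simp only [LinearMap.comp_apply, h1, Finsupp.lsingle_apply]
    by_cases hj : j ∈ s
    · rw [Finset.sum_eq_single_of_mem j hj fun b _ hb => Finsupp.single_eq_of_ne' hb,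
        Finsupp.single_eq_same]
    · rw [Finset.sum_eq_zero fun b hb => Finsupp.single_eq_of_ne' (by rintro rfl; exact hj hb)]
      by_contra hne
      exact hj (hs' a j (Ne.symm hne))
  | succ n ih =>
    intro M _ _ _ hM
    obtain ⟨k, p, hp⟩ := Module.Finite.exists_fin' R M
    have hs := IsShortExact.subtype hp
    exact hs.extVanishes_right
      (ih _ (hs.extVanishes_left (ExtOrthogonal.of_projective _ (by lia)) hM))
      (ExtOrthogonal.of_projective _ (by lia))

lemma ExtOrthogonal.finsupp_right [IsNoetherianRing R] {M A : Type u} [AddCommGroup M]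
    [Module R M] [Module.Finite R M] [AddCommGroup A] [Module R A] (h : ExtOrthogonal R M A)
    (ι : Type u) : ExtOrthogonal R M (ι →₀ A) := by
  intro i hi
  obtain ⟨n, rfl⟩ := Nat.exists_eq_add_of_le' hi
  exact ExtVanishes.finsupp_right ι n M (h _ hi)

end Finsupp

/-! ### A coinductive description of relative Gorenstein projective modules -/

/-- `Ext_R^i(M, A) = 0` for all `i ≥ 1` and every direct sum `A` of copies of `C`. -/
def SumOrthogonal (R : Type u) [CommRing R] (C M : Type u) [AddCommGroup C] [Module R C]
    [AddCommGroup M] [Module R M] : Prop :=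
  ∀ ι : Type u, ExtOrthogonal R M (ι →₀ C)

/-- A class `W` of `R`-modules orthogonal to all direct sums of copies of `C`, each member of
which embeds into such a direct sum with cokernel again in `W`. -/
structure IsCosyzygyClass (R : Type u) [CommRing R] (C : Type u) [AddCommGroup C] [Module R C]
    (W : ModuleCat.{u} R → Prop) : Prop where
  orthogonal : ∀ N, W N → SumOrthogonal R C N
  coresolve : ∀ N, W N → ∃ (ι : Type u) (N' : ModuleCat.{u} R) (f : N →ₗ[R] (ι →₀ C))
    (g : (ι →₀ C) →ₗ[R] N'), W N' ∧ IsShortExact f g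

/-- `M` belongs to the largest class `W` with `IsCosyzygyClass R C W`. This is a coinductive form
of being `C`-Gorenstein projective, with coresolutions by direct sums of copies of `C` instead of
modules `C ⊗ P`. -/
def IsSumGProjective (R : Type u) [CommRing R] (C M : Type u) [AddCommGroup C] [Module R C]
    [AddCommGroup M] [Module R M] : Prop :=
  ∃ W : ModuleCat.{u} R → Prop, IsCosyzygyClass R C W ∧ W (ModuleCat.of R M)

section

variable {R : Type u} [CommRing R] {C M : Type u} [AddCommGroup C] [Module R C]
  [AddCommGroup M] [Module R M]

lemma IsSumGProjective.orthogonal (h : IsSumGProjective R C M) : SumOrthogonal R C M := by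
  obtain ⟨W, hW, hM⟩ := h
  exact hW.orthogonal _ hM

lemma IsSumGProjective.coresolve (h : IsSumGProjective R C M) :
    ∃ (ι : Type u) (N : ModuleCat.{u} R) (f : M →ₗ[R] (ι →₀ C)) (g : (ι →₀ C) →ₗ[R] N),
      IsSumGProjective R C N ∧ IsShortExact f g := by
  obtain ⟨W, hW, hM⟩ := h
  obtain ⟨ι, N, f, g, hN, hs⟩ := hW.coresolve _ hM
  exact ⟨ι, N, f, g, ⟨W, hW, hN⟩, hs⟩

end

section TensorProjectiveClass

variable {R : Type u} [CommRing R] {C : Type u} [AddCommGroup C] [Module R C]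

lemma tensorProjectiveClass_finsupp (ι : Type u) :
    tensorProjectiveClass R C (ModuleCat.of R (ι →₀ C)) := by
  classical
  exact ⟨ModuleCat.of R (ι →₀ R), inferInstanceAs (Module.Projective R (ι →₀ R)),
    ⟨(TensorProduct.finsuppScalarRight R R C ι).symm⟩⟩

lemma tensorProjectiveClass_prod {A B : ModuleCat.{u} R} (hA : tensorProjectiveClass R C A)
    (hB : tensorProjectiveClass R C B) : tensorProjectiveClass R C (ModuleCat.of R (A × B)) := by
  obtain ⟨P, hP, ⟨e⟩⟩ := hA
  obtain ⟨Q, hQ, ⟨e'⟩⟩ := hB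
  exact ⟨ModuleCat.of R (P × Q), inferInstanceAs (Module.Projective R (P × Q)),
    ⟨(e.prodCongr e').trans (TensorProduct.prodRight R R C P Q).symm⟩⟩

/-- Members of `tensorProjectiveClass R C` are direct summands of direct sums of copies of `C`. -/
lemma tensorProjectiveClass_complement {A : ModuleCat.{u} R}
    (hA : tensorProjectiveClass R C A) : ∃ A' : ModuleCat.{u} R, tensorProjectiveClass R C A' ∧
      ∃ ι : Type u, Nonempty ((A × A') ≃ₗ[R] (ι →₀ C)) := by
  classical
  obtain ⟨P, hP, ⟨e⟩⟩ := hA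
  have hsurj := Finsupp.linearCombination_id_surjective R P
  obtain ⟨s, hs⟩ := Module.projective_lifting_property _ LinearMap.id hsurj
  obtain ⟨e', -⟩ := (LinearMap.exact_subtype_ker_map _).splitSurjectiveEquiv
    (Submodule.subtype_injective _) ⟨s, hs⟩
  let K := LinearMap.ker (Finsupp.linearCombination R (id : P → P))
  have hK : Module.Projective R K := by
    refine Module.Projective.of_split (M := P →₀ R)
      (e'.symm.toLinearMap ∘ₗ LinearMap.inl R K P) (LinearMap.fst R K P ∘ₗ e'.toLinearMap) ?_
    ext x
    simp
  refine ⟨ModuleCat.of R (C ⊗[R] K), ⟨ModuleCat.of R K, hK, ⟨.refl R _⟩⟩, P, ⟨?_⟩⟩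
  exact (e.prodCongr (.refl R _)).trans <| (TensorProduct.prodRight R R C P K).symm.trans <|
    (TensorProduct.congr (.refl R C) ((LinearEquiv.prodComm R P K).trans e'.symm)).trans
      (TensorProduct.finsuppScalarRight R R C P)

lemma SumOrthogonal.tensorProjectiveClass {M : Type u} [AddCommGroup M] [Module R M]
    (h : SumOrthogonal R C M) {A : ModuleCat.{u} R} (hA : tensorProjectiveClass R C A) :
    ExtOrthogonal R M A := by
  obtain ⟨A', -, ι, ⟨e⟩⟩ := tensorProjectiveClass_complement hA
  exact (h ι).of_retract_right (e.toLinearMap ∘ₗ LinearMap.inl R A A')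
    (LinearMap.fst R A A' ∘ₗ e.symm.toLinearMap) (by simp)

lemma SumOrthogonal.of_tensorProjectiveClass (hC : SumOrthogonal R C C) {A : ModuleCat.{u} R}
    (hA : _root_.tensorProjectiveClass R C A) : SumOrthogonal R C A := by
  obtain ⟨A', -, ι, ⟨e⟩⟩ := tensorProjectiveClass_complement hA
  exact fun κ => ((hC κ).finsupp_left ι).of_retract_left (e.toLinearMap ∘ₗ LinearMap.inl R A A')
    (LinearMap.fst R A A' ∘ₗ e.symm.toLinearMap) (by simp)

end TensorProjectiveClass

/-- Over any ring, the projective modules are the modules `S ⊗ P` with `P` projective. -/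
lemma tensorProjectiveClass_self (S : Type u) [CommRing S] :
    tensorProjectiveClass S S = projectiveClass S := by
  funext N
  refine propext ⟨?_, fun hN => ?_⟩
  · rintro ⟨P, hP, ⟨e⟩⟩
    exact Module.Projective.of_equiv (e.trans (TensorProduct.lid S P)).symm
  · exact ⟨N, hN, ⟨(TensorProduct.lid S N).symm⟩⟩

namespace CompleteResolution

variable {R : Type u} [CommRing R] {𝒬 : ModuleCat.{u} R → Prop} (X : CompleteResolution R 𝒬)

/-- The cokernel of the differential arriving in degree `i`. -/
abbrev cosyzygy (i : ℤ) : Type u := X.X i ⧸ LinearMap.range (X.d i)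

/-- The map from the cokernel in degree `i + 1` to `X i` induced by the differential. -/
def ofCosyzygy (i : ℤ) : X.cosyzygy (i + 1) →ₗ[R] X.X i :=
  (LinearMap.range (X.d (i + 1))).liftQ (X.d i) (by
    rintro _ ⟨x, rfl⟩
    exact (X.exact i).apply_apply_eq_zero x)

lemma isShortExact (i : ℤ) : IsShortExact (X.ofCosyzygy i) (LinearMap.range (X.d i)).mkQ := by
  refine ⟨?_, ?_, Submodule.mkQ_surjective _⟩
  · rw [← LinearMap.ker_eq_bot, eq_bot_iff]
    intro x hx
    obtain ⟨x, rfl⟩ := Submodule.mkQ_surjective _ x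
    exact (Submodule.Quotient.mk_eq_zero _).2 ((X.exact i x).1 hx)
  · rw [LinearMap.exact_iff, Submodule.ker_mkQ, ofCosyzygy, Submodule.range_liftQ]

lemma exists_extend {A : ModuleCat.{u} R} (hA : 𝒬 A) (i : ℤ)
    (φ : X.cosyzygy (i + 1) →ₗ[R] A) : ∃ ψ : X.X i →ₗ[R] A, ∀ x, ψ (X.ofCosyzygy i x) = φ x := by
  obtain ⟨ψ, hψ⟩ := (X.hom_exact A hA i (φ ∘ₗ (LinearMap.range (X.d (i + 1))).mkQ)).1 (by
    ext x
    have : (LinearMap.range (X.d (i + 1))).mkQ (X.d (i + 1) x) = 0 :=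
      (Submodule.Quotient.mk_eq_zero _).2 ⟨x, rfl⟩
    simpa using congrArg φ this)
  refine ⟨ψ, fun x => ?_⟩
  obtain ⟨x, rfl⟩ := Submodule.mkQ_surjective _ x
  exact LinearMap.congr_fun hψ x

lemma extVanishes_cosyzygy {A : ModuleCat.{u} R} (hA : 𝒬 A)
    (hX : ∀ i, ExtOrthogonal R (X.X i) A) (n : ℕ) :
    ∀ i : ℤ, ExtVanishes R (n + 1) (X.cosyzygy i) A := by
  induction n with
  | zero =>
    exact fun i => (X.isShortExact i).extVanishes_one_right (hX i 1 le_rfl)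
      (X.exists_extend hA i)
  | succ n ih =>
    exact fun i => (X.isShortExact i).extVanishes_right (ih (i + 1)) (hX i _ (by lia))

end CompleteResolution

namespace IsShortExact

variable {R : Type u} [CommRing R]

lemma congr {A B D A' B' D' : Type*} [AddCommGroup A] [Module R A] [AddCommGroup B] [Module R B]
    [AddCommGroup D] [Module R D] [AddCommGroup A'] [Module R A'] [AddCommGroup B'] [Module R B']
    [AddCommGroup D'] [Module R D'] {f : A →ₗ[R] B} {g : B →ₗ[R] D} (h : IsShortExact f g)
    (a : A' ≃ₗ[R] A) (b : B ≃ₗ[R] B') (d : D ≃ₗ[R] D') :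
    IsShortExact (b.toLinearMap ∘ₗ f ∘ₗ a.toLinearMap)
      (d.toLinearMap ∘ₗ g ∘ₗ b.symm.toLinearMap) := by
  refine ⟨b.injective.comp (h.injective.comp a.injective), ?_,
    d.surjective.comp (h.surjective.comp b.symm.surjective)⟩
  intro x
  simp only [LinearMap.comp_apply, LinearEquiv.coe_coe, map_eq_zero_iff _ d.injective,
    Set.mem_range]
  rw [h.exact (b.symm x)]
  constructor
  · rintro ⟨y, hy⟩
    exact ⟨a.symm y, by simp [hy]⟩
  · rintro ⟨y, rfl⟩
    exact ⟨a y, by simp⟩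

end IsShortExact

section Comparison

variable {R : Type u} [CommRing R] {C M : Type u} [AddCommGroup C] [Module R C]
  [AddCommGroup M] [Module R M]

/-- Adding a complement to each module `C ⊗ P` of a complete resolution turns its cosyzygies into
a cosyzygy class. -/
lemma IsCGorensteinProjective.isSumGProjective (hC : SumOrthogonal R C C)
    (h : IsCGorensteinProjective R C M) : IsSumGProjective R C M := by
  obtain ⟨X, ⟨e⟩⟩ := h
  have hX : ∀ (i : ℤ) (A : ModuleCat.{u} R), tensorProjectiveClass R C A →
      ExtOrthogonal R (X.X i) A := by
    intro i A hA
    rcases le_or_gt 0 i with hi | hi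
    · have := X.projective i hi
      exact ExtOrthogonal.of_projective
    · exact (hC.of_tensorProjectiveClass (X.mem i (by lia))).tensorProjectiveClass hA
  refine ⟨fun N => ∃ i : ℤ, i ≤ 0 ∧ ∃ A : ModuleCat.{u} R, tensorProjectiveClass R C A ∧
    Nonempty (N ≃ₗ[R] (X.cosyzygy i × A)), ⟨?_, ?_⟩, ?_⟩
  · rintro N ⟨i, -, A, hA, ⟨e⟩⟩ ι
    refine ExtOrthogonal.of_equiv_left ?_ e
    refine IsShortExact.inl_snd.extOrthogonal_middle (fun j hj => ?_)
      (hC.of_tensorProjectiveClass hA ι)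
    obtain ⟨n, rfl⟩ := Nat.exists_eq_add_of_le' hj
    exact X.extVanishes_cosyzygy (A := ModuleCat.of R (ι →₀ C)) (tensorProjectiveClass_finsupp ι)
      (fun i => hX i _ (tensorProjectiveClass_finsupp ι)) n i
  · rintro N ⟨i, hi, A, hA, ⟨e⟩⟩
    obtain ⟨k, rfl⟩ : ∃ k, i = k + 1 := ⟨i - 1, by lia⟩
    obtain ⟨A', hA', ι, ⟨b⟩⟩ := tensorProjectiveClass_complement
      (tensorProjectiveClass_prod (X.mem k (by lia)) hA)
    have hs : IsShortExact
        (LinearMap.inl R (X.X k × A) A' ∘ₗ (X.ofCosyzygy k).prodMap LinearMap.id)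
        (((LinearMap.range (X.d k)).mkQ ∘ₗ LinearMap.fst R (X.X k) A).prodMap
          (LinearMap.id : A' →ₗ[R] A')) := by
      have h0 := X.isShortExact k
      refine ⟨LinearMap.inl_injective.comp (h0.injective.prodMap Function.injective_id), ?_,
        (h0.surjective.comp LinearMap.fst_surjective).prodMap Function.surjective_id⟩
      rintro ⟨⟨x, a⟩, a'⟩
      constructor
      · intro hx
        obtain ⟨y, rfl⟩ := (h0.exact x).1 (congrArg Prod.fst hx)
        obtain rfl : a' = 0 := congrArg Prod.snd hx
        exact ⟨(y, a), rfl⟩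
      · rintro ⟨⟨y, b⟩, hy⟩
        obtain ⟨⟨rfl, rfl⟩, rfl⟩ : (X.ofCosyzygy k y = x ∧ b = a) ∧ 0 = a' := by
          simpa [Prod.ext_iff] using hy
        exact Prod.ext (h0.exact.apply_apply_eq_zero y) rfl
    exact ⟨ι, ModuleCat.of R (X.cosyzygy k × A'), _, _,
      ⟨k, by lia, A', hA', ⟨.refl R _⟩⟩, hs.congr e b (.refl R _)⟩
  · refine ⟨0, le_rfl, ModuleCat.of R (PEmpty →₀ C), tensorProjectiveClass_finsupp _, ⟨?_⟩⟩
    exact e.symm.trans (LinearEquiv.prodUnique (M₂ := PEmpty →₀ C)).symm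

/-- Splicing short exact sequences `0 → Z (i + 1) → X i → Z i → 0` yields a complete
resolution. -/
lemma exists_completeResolution {𝒬 : ModuleCat.{u} R → Prop} (Z : ℤ → ModuleCat.{u} R)
    (hZ : ∀ (i : ℤ) (A : ModuleCat.{u} R), 𝒬 A → ExtVanishes R 1 (Z i) A)
    (hs : ∀ i : ℤ, ∃ (X : ModuleCat.{u} R) (f : Z (i + 1) →ₗ[R] X) (g : X →ₗ[R] Z i),
      (0 ≤ i → Module.Projective R X) ∧ (i ≤ -1 → 𝒬 X) ∧ IsShortExact f g) :
    ∃ X : CompleteResolution R 𝒬, Nonempty (X.coker ≃ₗ[R] Z 0) := by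
  choose X f g hP hQ hfg using hs
  let Y : CompleteResolution R 𝒬 :=
    { X := X
      d := fun i => f i ∘ₗ g (i + 1)
      exact := by
        intro i x
        constructor
        · intro hx
          obtain ⟨z, rfl⟩ := ((hfg (i + 1)).exact x).1
            ((hfg i).injective (by simpa using hx))
          obtain ⟨y, rfl⟩ := (hfg (i + 1 + 1)).surjective z
          exact ⟨y, rfl⟩
        · rintro ⟨y, rfl⟩
          simp [(hfg (i + 1)).exact.apply_apply_eq_zero]
      projective := hP
      mem := hQ
      hom_exact := by
        intro A hA i φ
        constructor
        · intro hφ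
          obtain ⟨ψ, hψ⟩ := (hfg (i + 1)).exists_factor φ (fun z => by
            obtain ⟨y, rfl⟩ := (hfg (i + 1 + 1)).surjective z
            exact LinearMap.congr_fun hφ y)
          obtain ⟨χ, hχ⟩ := (hfg i).exists_extend (hZ i A hA) ψ
          refine ⟨χ, ?_⟩
          ext x
          exact (hχ _).trans (hψ x)
        · rintro ⟨ψ, rfl⟩
          ext x
          simp [(hfg (i + 1)).exact.apply_apply_eq_zero] }
  have hr : LinearMap.range (Y.d 0) = LinearMap.ker (g 0) := by
    rw [← (LinearMap.exact_iff.1 (hfg 0).exact).symm]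
    exact LinearMap.range_comp_of_range_eq_top _ (LinearMap.range_eq_top.2 (hfg _).surjective)
  exact ⟨Y, ⟨(Submodule.quotEquivOfEq _ _ hr).trans
    ((g 0).quotKerEquivOfSurjective (hfg 0).surjective)⟩⟩

lemma exists_syzygies (M : ModuleCat.{u} R) : ∃ s : ℕ → ModuleCat.{u} R, s 0 = M ∧
    ∀ n, ∃ (f : s (n + 1) →ₗ[R] (s n →₀ R)) (g : (s n →₀ R) →ₗ[R] s n), IsShortExact f g := by
  have hfree : ∀ N : ModuleCat.{u} R, ∃ (K : ModuleCat.{u} R) (p : K →ₗ[R] (N →₀ R))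
      (q : (N →₀ R) →ₗ[R] N), IsShortExact p q := fun N =>
    ⟨ModuleCat.of R (LinearMap.ker (Finsupp.linearCombination R (id : N → N))), _, _,
      IsShortExact.subtype (Finsupp.linearCombination_id_surjective R N)⟩
  choose K p q hpq using hfree
  exact ⟨fun n => n.rec M fun _ N => K N, rfl, fun n => ⟨_, _, hpq _⟩⟩

lemma IsCosyzygyClass.exists_cosyzygies {W : ModuleCat.{u} R → Prop} (hW : IsCosyzygyClass R C W)
    {M : ModuleCat.{u} R} (hM : W M) : ∃ w : ℕ → ModuleCat.{u} R, w 0 = M ∧ (∀ n, W (w n)) ∧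
      ∀ n, ∃ (ι : Type u) (f : w n →ₗ[R] (ι →₀ C)) (g : (ι →₀ C) →ₗ[R] w (n + 1)),
        IsShortExact f g := by
  choose ι N' f g hN' hfg using hW.coresolve
  let w : ℕ → {N : ModuleCat.{u} R // W N} :=
    fun n => n.rec ⟨_, hM⟩ fun _ N => ⟨N' N.1 N.2, hN' N.1 N.2⟩
  exact ⟨fun n => (w n).1, rfl, fun n => (w n).2, fun n => ⟨_, _, _, hfg _ (w n).2⟩⟩

lemma IsSumGProjective.isCGorensteinProjective (h : IsSumGProjective R C M) :
    IsCGorensteinProjective R C M := by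
  obtain ⟨W, hW, hM⟩ := h
  obtain ⟨s, hs0, hs⟩ := exists_syzygies (ModuleCat.of R M)
  obtain ⟨w, hw0, hwW, hw⟩ := hW.exists_cosyzygies hM
  have hsO : ∀ n, SumOrthogonal R C (s n) := by
    intro n
    induction n with
    | zero =>
      rw [hs0]
      exact hW.orthogonal _ hM
    | succ n ih =>
      obtain ⟨f, g, hfg⟩ := hs n
      exact fun κ i hi => hfg.extVanishes_left (ExtOrthogonal.of_projective i hi)
        (ih κ (i + 1) (by lia))
  let Z : ℤ → ModuleCat.{u} R := fun i => match i with
    | .ofNat n => s n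
    | .negSucc n => w (n + 1)
  obtain ⟨X, ⟨e⟩⟩ : ∃ X : CompleteResolution R (tensorProjectiveClass R C),
      Nonempty (X.coker ≃ₗ[R] Z 0) := by
    refine exists_completeResolution Z (fun i A hA => ?_) (fun i => ?_)
    · rcases i with n | n
      · exact (hsO n).tensorProjectiveClass hA 1 le_rfl
      · exact (hW.orthogonal _ (hwW (n + 1))).tensorProjectiveClass hA 1 le_rfl
    · rcases i with n | n
      · obtain ⟨f, g, hfg⟩ := hs n
        exact ⟨ModuleCat.of R (s n →₀ R), f, g,
          fun _ => inferInstanceAs (Module.Projective R (s n →₀ R)),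
          fun h => absurd h (by simp only [Int.ofNat_eq_natCast]; lia), hfg⟩
      · have hneg : ¬ (0 : ℤ) ≤ Int.negSucc n := by simp
        rcases n with _ | n
        · obtain ⟨ι, f, g, hfg⟩ := hw 0
          rw [show Z (Int.negSucc 0 + 1) = w 0 from hs0.trans hw0.symm]
          exact ⟨ModuleCat.of R (ι →₀ C), f, g, fun h => absurd h hneg,
            fun _ => tensorProjectiveClass_finsupp _, hfg⟩
        · obtain ⟨ι, f, g, hfg⟩ := hw (n + 1)
          exact ⟨ModuleCat.of R (ι →₀ C), f, g, fun h => absurd h hneg,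
            fun _ => tensorProjectiveClass_finsupp _, hfg⟩
  have e' : Nonempty (Z 0 ≃ₗ[R] M) := by
    rw [show Z 0 = ModuleCat.of R M from hs0]
    exact ⟨.refl R M⟩
  exact ⟨X, e'.map e.trans⟩

/-- Being `C`-Gorenstein projective agrees with its coinductive form as soon as
`Ext^i(C, A) = 0` for `i ≥ 1` and all direct sums `A` of copies of `C`. -/
theorem isCGorensteinProjective_iff (hC : SumOrthogonal R C C) :
    IsCGorensteinProjective R C M ↔ IsSumGProjective R C M :=
  ⟨fun h => h.isSumGProjective hC, fun h => h.isCGorensteinProjective⟩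

end Comparison

theorem isGorensteinProjective_iff {S N : Type u} [CommRing S] [AddCommGroup N] [Module S N] :
    IsGorensteinProjective S N ↔ IsSumGProjective S S N := by
  rw [← isCGorensteinProjective_iff fun _ => ExtOrthogonal.of_projective, IsGorensteinProjective,
    ← tensorProjectiveClass_self, IsCGorensteinProjective]

/-! ### Closure properties of relative Gorenstein projective modules -/

namespace IsShortExact

variable {R : Type*} [CommRing R]

/-- The third isomorphism theorem: submodules `A ⊆ B ⊆ E` give a short exact sequence
`0 → B / A → E / A → E / B → 0`. -/
lemma exists_quotient {A B D E F : Type*} [AddCommGroup A] [Module R A] [AddCommGroup B]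
    [Module R B] [AddCommGroup D] [Module R D] [AddCommGroup E] [Module R E] [AddCommGroup F]
    [Module R F] {f : A →ₗ[R] B} {g : B →ₗ[R] D} {i : B →ₗ[R] E} {p : E →ₗ[R] F}
    (h : IsShortExact f g) (h' : IsShortExact i p) :
    ∃ (k : D →ₗ[R] E ⧸ LinearMap.range (i ∘ₗ f)) (l : (E ⧸ LinearMap.range (i ∘ₗ f)) →ₗ[R] F),
      IsShortExact (i ∘ₗ f) (LinearMap.range (i ∘ₗ f)).mkQ ∧ IsShortExact k l := by
  obtain ⟨k, hk⟩ := h.exists_factor ((LinearMap.range (i ∘ₗ f)).mkQ ∘ₗ i)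
    (fun a => (Submodule.Quotient.mk_eq_zero _).2 ⟨a, rfl⟩)
  have hq := IsShortExact.mkQ (f := i ∘ₗ f) (h'.injective.comp h.injective)
  obtain ⟨l, hl⟩ := hq.exists_factor p (fun a => h'.exact.apply_apply_eq_zero (f a))
  refine ⟨k, l, hq, ?_, ?_, ?_⟩
  · refine (injective_iff_map_eq_zero k).2 fun d hd => ?_
    obtain ⟨b, rfl⟩ := h.surjective d
    rw [hk] at hd
    obtain ⟨a, ha⟩ := (Submodule.Quotient.mk_eq_zero _).1 hd
    rw [← h'.injective ha]
    exact h.exact.apply_apply_eq_zero a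
  · intro x
    obtain ⟨x, rfl⟩ := Submodule.mkQ_surjective _ x
    rw [hl]
    constructor
    · intro hx
      obtain ⟨b, rfl⟩ := (h'.exact x).1 hx
      exact ⟨g b, hk b⟩
    · rintro ⟨d, hd⟩
      obtain ⟨b, rfl⟩ := h.surjective d
      rw [← hl, ← hd, hk]
      exact (hl _).trans (h'.exact.apply_apply_eq_zero b)
  · intro y
    obtain ⟨x, rfl⟩ := h'.surjective y
    exact ⟨_, hl x⟩

/-- The horseshoe lemma: given `0 → A → B → D → 0` and embeddings of `A` and `D`, the first of
which extends to `B`, the module `B` embeds into the product, with cokernel an extension of the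
two cokernels. -/
lemma exists_horseshoe {A B D T T' U U' : Type*} [AddCommGroup A] [Module R A] [AddCommGroup B]
    [Module R B] [AddCommGroup D] [Module R D] [AddCommGroup T] [Module R T] [AddCommGroup T']
    [Module R T'] [AddCommGroup U] [Module R U] [AddCommGroup U'] [Module R U']
    {f : A →ₗ[R] B} {g : B →ₗ[R] D} {a : A →ₗ[R] T} {a' : T →ₗ[R] T'} {d : D →ₗ[R] U}
    {d' : U →ₗ[R] U'} (h : IsShortExact f g) (ha : IsShortExact a a') (hd : IsShortExact d d')
    (α : B →ₗ[R] T) (hα : ∀ x, α (f x) = a x) :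
    ∃ (k : T' →ₗ[R] (T × U) ⧸ LinearMap.range (α.prod (d ∘ₗ g)))
      (l : ((T × U) ⧸ LinearMap.range (α.prod (d ∘ₗ g))) →ₗ[R] U'),
      IsShortExact (α.prod (d ∘ₗ g)) (LinearMap.range (α.prod (d ∘ₗ g))).mkQ ∧
        IsShortExact k l := by
  have hq : IsShortExact (α.prod (d ∘ₗ g)) (LinearMap.range (α.prod (d ∘ₗ g))).mkQ := by
    refine IsShortExact.mkQ ((injective_iff_map_eq_zero _).2 fun b hb => ?_)
    have h1 : α b = 0 := congrArg Prod.fst hb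
    have h2 : d (g b) = 0 := congrArg Prod.snd hb
    obtain ⟨x, rfl⟩ := (h.exact b).1 ((map_eq_zero_iff d hd.injective).1 h2)
    rw [hα, map_eq_zero_iff a ha.injective] at h1
    rw [h1, map_zero]
  obtain ⟨k, hk⟩ := ha.exists_factor
    ((LinearMap.range (α.prod (d ∘ₗ g))).mkQ ∘ₗ LinearMap.inl R T U)
    (fun x => (Submodule.Quotient.mk_eq_zero _).2
      ⟨f x, Prod.ext (hα x) (by simp [h.exact.apply_apply_eq_zero])⟩)
  obtain ⟨l, hl⟩ := hq.exists_factor (d' ∘ₗ LinearMap.snd R T U)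
    (fun b => hd.exact.apply_apply_eq_zero (g b))
  refine ⟨k, l, hq, ?_, ?_, ?_⟩
  · refine (injective_iff_map_eq_zero k).2 fun y hy => ?_
    obtain ⟨t, rfl⟩ := ha.surjective y
    rw [hk] at hy
    obtain ⟨b, hb⟩ := (Submodule.Quotient.mk_eq_zero _).1 hy
    have h1 : α b = t := congrArg Prod.fst hb
    have h2 : d (g b) = 0 := congrArg Prod.snd hb
    obtain ⟨x, rfl⟩ := (h.exact b).1 ((map_eq_zero_iff d hd.injective).1 h2)
    rw [← h1, hα]
    exact ha.exact.apply_apply_eq_zero x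
  · intro x
    obtain ⟨⟨t, v⟩, rfl⟩ := Submodule.mkQ_surjective _ x
    rw [hl]
    constructor
    · intro hv
      obtain ⟨y, rfl⟩ := (hd.exact v).1 hv
      obtain ⟨b, rfl⟩ := h.surjective y
      refine ⟨a' (t - α b), ?_⟩
      rw [hk]
      refine (Submodule.Quotient.eq _).2 ⟨-b, ?_⟩
      simp
    · rintro ⟨y, hy⟩
      obtain ⟨t', rfl⟩ := ha.surjective y
      rw [← hl, ← hy, hk]
      exact (hl (t', 0)).trans (map_zero d')
  · intro y
    obtain ⟨v, rfl⟩ := hd.surjective y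
    exact ⟨_, hl (0, v)⟩

end IsShortExact

section Closure

variable {R : Type u} [CommRing R] {C : Type u} [AddCommGroup C] [Module R C]

lemma IsSumGProjective.of_equiv {M N : Type u} [AddCommGroup M] [Module R M] [AddCommGroup N]
    [Module R N] (h : IsSumGProjective R C M) (e : N ≃ₗ[R] M) : IsSumGProjective R C N := by
  refine ⟨fun L => ∃ K : ModuleCat.{u} R, IsSumGProjective R C K ∧ Nonempty (L ≃ₗ[R] K),
    ⟨?_, ?_⟩, ModuleCat.of R M, h, ⟨e⟩⟩
  · rintro L ⟨K, hK, ⟨e⟩⟩ ι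
    exact (hK.orthogonal ι).of_equiv_left e
  · rintro L ⟨K, hK, ⟨e⟩⟩
    obtain ⟨ι, K', f, g, hK', hs⟩ := hK.coresolve
    exact ⟨ι, K', _, _, ⟨K', hK', ⟨.refl R _⟩⟩, hs.congr e (.refl R _) (.refl R _)⟩

lemma IsSumGProjective.finsupp_self (hC : SumOrthogonal R C C) (ι : Type u) :
    IsSumGProjective R C (ι →₀ C) := by
  refine ⟨fun N => ∃ κ : Type u, Nonempty (N ≃ₗ[R] (κ →₀ C)), ⟨?_, ?_⟩, ι, ⟨.refl R _⟩⟩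
  · rintro N ⟨κ, ⟨e⟩⟩ μ
    exact ((hC μ).finsupp_left κ).of_equiv_left e
  · rintro N ⟨κ, ⟨e⟩⟩
    refine ⟨κ, ModuleCat.of R (PEmpty →₀ C), e.toLinearMap, 0, ⟨PEmpty, ⟨.refl R _⟩⟩,
      e.injective, ?_, fun x => ⟨0, Subsingleton.elim _ _⟩⟩
    exact fun x => ⟨fun _ => e.surjective x, fun _ => rfl⟩

lemma IsSumGProjective.finsupp {M : Type u} [AddCommGroup M] [Module R M]
    (h : IsSumGProjective R C M) (ι : Type u) : IsSumGProjective R C (ι →₀ M) := by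
  refine ⟨fun L => ∃ K : ModuleCat.{u} R, IsSumGProjective R C K ∧ Nonempty (L ≃ₗ[R] (ι →₀ K)),
    ⟨?_, ?_⟩, ModuleCat.of R M, h, ⟨.refl R _⟩⟩
  · rintro L ⟨K, hK, ⟨e⟩⟩ κ
    exact ((hK.orthogonal κ).finsupp_left ι).of_equiv_left e
  · rintro L ⟨K, hK, ⟨e⟩⟩
    obtain ⟨κ, K', f, g, hK', hs⟩ := hK.coresolve
    exact ⟨ι × κ, ModuleCat.of R (ι →₀ K'), _, _, ⟨K', hK', ⟨.refl R _⟩⟩,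
      (hs.finsupp ι).congr e (Finsupp.curryLinearEquiv R).symm (.refl R _)⟩

lemma IsSumGProjective.extension {A B D : Type u} [AddCommGroup A] [Module R A] [AddCommGroup B]
    [Module R B] [AddCommGroup D] [Module R D] {f : A →ₗ[R] B} {g : B →ₗ[R] D}
    (h : IsShortExact f g) (hA : IsSumGProjective R C A) (hD : IsSumGProjective R C D) :
    IsSumGProjective R C B := by
  refine ⟨fun N => ∃ (A D : ModuleCat.{u} R) (f : A →ₗ[R] N) (g : N →ₗ[R] D),
    IsSumGProjective R C A ∧ IsSumGProjective R C D ∧ IsShortExact f g, ⟨?_, ?_⟩,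
    ModuleCat.of R A, ModuleCat.of R D, f, g, hA, hD, h⟩
  · rintro N ⟨A, D, f, g, hA, hD, h⟩ ι
    exact h.extOrthogonal_middle (hA.orthogonal ι) (hD.orthogonal ι)
  · rintro N ⟨A, D, f, g, hA, hD, h⟩
    obtain ⟨ι, A', a, a', hA', ha⟩ := hA.coresolve
    obtain ⟨κ, D', d, d', hD', hd⟩ := hD.coresolve
    obtain ⟨α, hα⟩ := h.exists_extend (hD.orthogonal ι 1 le_rfl) a
    obtain ⟨k, l, hs, hkl⟩ := h.exists_horseshoe ha hd α hα
    exact ⟨ι ⊕ κ, ModuleCat.of R (((ι →₀ C) × (κ →₀ C)) ⧸ LinearMap.range (α.prod (d ∘ₗ g))),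
      _, _, ⟨A', D', k, l, hA', hD', hkl⟩,
      hs.congr (.refl R _) (Finsupp.sumFinsuppLEquivProdFinsupp R).symm (.refl R _)⟩

/-- Coresolutions by relative Gorenstein projective modules, with orthogonal cosyzygies, do not
lead outside the class of relative Gorenstein projective modules. The cosyzygies arising are
extensions of a relative Gorenstein projective module by a member of the given class `𝒳`. -/
lemma IsSumGProjective.of_coresolution (𝒳 : ModuleCat.{u} R → Prop)
    (horth : ∀ N, 𝒳 N → SumOrthogonal R C N)
    (hcores : ∀ N, 𝒳 N → ∃ (G N' : ModuleCat.{u} R) (f : N →ₗ[R] G) (g : G →ₗ[R] N'),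
      IsSumGProjective R C G ∧ 𝒳 N' ∧ IsShortExact f g)
    {M : ModuleCat.{u} R} (hM : 𝒳 M) : IsSumGProjective R C M := by
  refine ⟨fun K => ∃ (N Q : ModuleCat.{u} R) (f : N →ₗ[R] K) (g : K →ₗ[R] Q),
    𝒳 N ∧ IsSumGProjective R C Q ∧ IsShortExact f g, ⟨?_, ?_⟩, ?_⟩
  · rintro K ⟨N, Q, f, g, hN, hQ, h⟩ ι
    exact h.extOrthogonal_middle (horth N hN ι) (hQ.orthogonal ι)
  · rintro K ⟨N, Q, f, g, hN, hQ, h⟩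
    obtain ⟨G, N', i, p, hG, hN', hip⟩ := hcores N hN
    obtain ⟨ι, G', a, a', hG', ha⟩ := hG.coresolve
    obtain ⟨κ, Q', d, d', hQ', hd⟩ := hQ.coresolve
    obtain ⟨k, l, hs, hkl⟩ := hip.exists_quotient ha
    obtain ⟨α, hα⟩ := h.exists_extend (hQ.orthogonal ι 1 le_rfl) (a ∘ₗ i)
    obtain ⟨k', l', hs', hkl'⟩ := h.exists_horseshoe hs hd α hα
    -- The cokernel `K'` of the embedding of `K` is filtered by `N'`, `G'` and `Q'`.
    obtain ⟨k'', l'', hs'', hkl''⟩ := hkl.exists_quotient hkl'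
    exact ⟨ι ⊕ κ, ModuleCat.of R (((ι →₀ C) × (κ →₀ C)) ⧸ LinearMap.range (α.prod (d ∘ₗ g))),
      _, _, ⟨N', ModuleCat.of R _, _, _, hN', .extension hkl'' hG' hQ', hs''⟩,
      hs'.congr (.refl R _) (Finsupp.sumFinsuppLEquivProdFinsupp R).symm (.refl R _)⟩
  · exact ⟨M, ModuleCat.of R PUnit, LinearMap.id, 0, hM,
      ⟨fun N => Subsingleton N, ⟨fun N hN ι i hi => ExtOrthogonal.of_projective i hi,
        fun N hN => ⟨PEmpty, ModuleCat.of R PUnit, 0, 0, inferInstanceAs (Subsingleton PUnit),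
          Function.injective_of_subsingleton _, fun x => ⟨fun _ => ⟨0, Subsingleton.elim _ _⟩,
            fun _ => rfl⟩, fun x => ⟨0, Subsingleton.elim _ _⟩⟩⟩,
        inferInstanceAs (Subsingleton PUnit)⟩,
      Function.injective_id, fun x => ⟨fun _ => ⟨x, rfl⟩, fun _ => rfl⟩,
      fun x => ⟨0, Subsingleton.elim _ _⟩⟩

end Closure

/-! ### The ring is `C`-Gorenstein projective over itself -/

lemma IsShortExact.lcomp {R : Type u} [CommRing R] {A B D T : Type u} [AddCommGroup A]
    [Module R A] [AddCommGroup B] [Module R B] [AddCommGroup D] [Module R D] [AddCommGroup T]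
    [Module R T] {f : A →ₗ[R] B} {g : B →ₗ[R] D} (h : IsShortExact f g)
    (hD : ExtVanishes R 1 D T) : IsShortExact (g.lcomp R T) (f.lcomp R T) := by
  refine ⟨fun φ ψ hφ => ?_, fun φ => ⟨fun hφ => ?_, ?_⟩, fun φ => ?_⟩
  · ext d
    obtain ⟨b, rfl⟩ := h.surjective d
    exact LinearMap.congr_fun hφ b
  · obtain ⟨ψ, hψ⟩ := h.exists_factor φ (LinearMap.congr_fun hφ)
    exact ⟨ψ, LinearMap.ext hψ⟩
  · rintro ⟨ψ, rfl⟩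
    ext a
    simp [h.exact.apply_apply_eq_zero]
  · obtain ⟨ψ, hψ⟩ := h.exists_extend hD φ
    exact ⟨ψ, LinearMap.ext hψ⟩

/-- `K` is totally `C`-reflexive: finitely generated, biduality `K → Hom(Hom(K, C), C)` is
bijective, and `Ext^i(K, C) = 0 = Ext^i(Hom(K, C), C)` for `i ≥ 1`. -/
structure IsTotallyReflexive (R : Type u) [CommRing R] (C K : Type u) [AddCommGroup C]
    [Module R C] [AddCommGroup K] [Module R K] : Prop where
  finite : Module.Finite R K
  orthogonal : ExtOrthogonal R K C
  dual_orthogonal : ExtOrthogonal R (K →ₗ[R] C) C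
  injective : ∀ x : K, (∀ φ : K →ₗ[R] C, φ x = 0) → x = 0
  surjective : ∀ θ : (K →ₗ[R] C) →ₗ[R] C, ∃ x : K, ∀ φ, θ φ = φ x

section Semidualizing

variable {R : Type u} [CommRing R] {C : Type u} [AddCommGroup C] [Module R C]

/-- If `R` and `Hom(C, C)` are isomorphic, every endomorphism of `C` is a homothety: if `φ` is
the image of `1` and `id = r • φ`, then `φ = r • φ²` is a multiple of `r • φ = id`. -/
lemma IsSemidualizing.exists_smul (hC : IsSemidualizing R C) (ψ : C →ₗ[R] C) :
    ∃ r : R, ∀ c, ψ c = r • c := by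
  obtain ⟨e⟩ := hC.end_equiv
  have hgen : ∀ χ : C →ₗ[R] C, ∃ r : R, χ = r • e 1 := fun χ =>
    ⟨e.symm χ, by rw [← map_smul, smul_eq_mul, mul_one, e.apply_symm_apply]⟩
  obtain ⟨r, hr⟩ := hgen LinearMap.id
  obtain ⟨t, ht⟩ := hgen (e 1 ∘ₗ e 1)
  obtain ⟨s, hs⟩ := hgen ψ
  have hid : ∀ c, c = r • e 1 c := fun c => LinearMap.congr_fun hr c
  have hsq : ∀ c, e 1 (e 1 c) = t • e 1 c := fun c => LinearMap.congr_fun ht c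
  have hφ : ∀ c, e 1 c = t • c := fun c => by
    rw [hid (e 1 c), hsq, smul_comm, ← hid]
  exact ⟨s * t, fun c => by rw [hs, LinearMap.smul_apply, hφ, mul_smul]⟩

lemma IsSemidualizing.eq_zero_of_smul (hC : IsSemidualizing R C) {r : R}
    (hr : ∀ c : C, r • c = 0) : r = 0 := by
  obtain ⟨e⟩ := hC.end_equiv
  apply e.injective
  rw [map_zero, ← mul_one r, ← smul_eq_mul, map_smul]
  ext c
  exact hr _

lemma IsSemidualizing.orthogonal_self (hC : IsSemidualizing R C) : ExtOrthogonal R C C :=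
  hC.ext_vanishing

lemma IsSemidualizing.sumOrthogonal [IsNoetherianRing R] (hC : IsSemidualizing R C) :
    SumOrthogonal R C C := by
  have := hC.finite
  exact fun ι => hC.orthogonal_self.finsupp_right ι

lemma IsSemidualizing.isTotallyReflexive (hC : IsSemidualizing R C) :
    IsTotallyReflexive R C C where
  finite := hC.finite
  orthogonal := hC.orthogonal_self
  dual_orthogonal := by
    obtain ⟨e⟩ := hC.end_equiv
    exact (ExtOrthogonal.of_projective (M := R)).of_equiv_left e.symm
  injective x hx := hx LinearMap.id
  surjective θ := by
    refine ⟨θ LinearMap.id, fun φ => ?_⟩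
    obtain ⟨r, hr⟩ := hC.exists_smul φ
    have : φ = r • LinearMap.id := LinearMap.ext hr
    rw [this, map_smul, LinearMap.smul_apply, LinearMap.id_apply]

/-- Every linear map `Hom(F, C) → C`, for `F` free of finite rank, is an evaluation. -/
lemma IsSemidualizing.exists_eval (hC : IsSemidualizing R C) {ι : Type*} [Fintype ι]
    (θ : ((ι →₀ R) →ₗ[R] C) →ₗ[R] C) : ∃ v : ι →₀ R, ∀ φ, θ φ = φ v := by
  classical
  choose r hr using fun i => hC.exists_smul
    (θ ∘ₗ (Finsupp.lapply (R := R) i).smulRightₗ (M := C))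
  refine ⟨∑ i, Finsupp.single i (r i), fun φ => ?_⟩
  have hφ : φ = ∑ i, (Finsupp.lapply (R := R) i).smulRightₗ (φ (Finsupp.single i 1)) := by
    ext j
    simp [Finsupp.single_apply]
  conv_lhs => rw [hφ]
  rw [map_sum, map_sum]
  refine Finset.sum_congr rfl fun i _ => (hr i _).trans ?_
  rw [← map_smul, Finsupp.smul_single_one]

/-- The dual of a free module of finite rank is a direct sum of copies of `C`. -/
noncomputable def dualFreeEquiv (R C : Type*) [CommRing R] [AddCommGroup C] [Module R C]
    (ι : Type*) [Finite ι] : ((ι →₀ R) →ₗ[R] C) ≃ₗ[R] (ι →₀ C) :=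
  ((Finsupp.linearEquivFunOnFinite R C ι).trans (Finsupp.llift C R R ι)).symm

lemma IsTotallyReflexive.syzygy [IsNoetherianRing R] (hC : IsSemidualizing R C) {K : Type u}
    [AddCommGroup K] [Module R K] (hK : IsTotallyReflexive R C K) {ι : Type u} [Fintype ι]
    {p : (ι →₀ R) →ₗ[R] K} (hp : Function.Surjective p) :
    IsTotallyReflexive R C (LinearMap.ker p) := by
  have hs := IsShortExact.subtype hp
  have hd := hs.lcomp (T := C) (hK.orthogonal 1 le_rfl)
  refine ⟨inferInstance, fun i hi => hs.extVanishes_left (ExtOrthogonal.of_projective i hi)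
    (hK.orthogonal (i + 1) (by lia)), ?_, ?_, ?_⟩
  · refine hd.extOrthogonal_right hK.dual_orthogonal
      ((hC.orthogonal_self.finsupp_left ι).of_equiv_left (dualFreeEquiv R C ι)) fun θ => ?_
    obtain ⟨x, hx⟩ := hK.surjective θ
    obtain ⟨v, rfl⟩ := hp x
    exact ⟨LinearMap.applyₗ v, fun φ => (hx φ).symm⟩
  · rintro ⟨v, hv⟩ h
    refine Subtype.ext (Finsupp.ext fun i => hC.eq_zero_of_smul fun c => ?_)
    exact h (((Finsupp.lapply (R := R) i).smulRight c) ∘ₗ (LinearMap.ker p).subtype)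
  · intro θ
    obtain ⟨v, hv⟩ := hC.exists_eval (θ ∘ₗ (LinearMap.ker p).subtype.lcomp R C)
    have hvp : p v = 0 := by
      refine hK.injective _ fun φ => ?_
      have h0 : (LinearMap.ker p).subtype.lcomp R C (p.lcomp R C φ) = 0 :=
        hd.exact.apply_apply_eq_zero φ
      have := hv (p.lcomp R C φ)
      rw [LinearMap.comp_apply, h0, map_zero] at this
      exact this.symm
    refine ⟨⟨v, hvp⟩, fun ψ => ?_⟩
    obtain ⟨φ, rfl⟩ := hd.surjective ψ
    exact hv φ

/-- The duals of totally `C`-reflexive modules form a cosyzygy class: dualizing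
`0 → L → F → K → 0` with `F` free of finite rank gives `0 → K* → F* → L* → 0`, and `F*` is a
direct sum of copies of `C`. -/
lemma IsTotallyReflexive.isSumGProjective_dual [IsNoetherianRing R] (hC : IsSemidualizing R C)
    {K : Type u} [AddCommGroup K] [Module R K] (hK : IsTotallyReflexive R C K) :
    IsSumGProjective R C (K →ₗ[R] C) := by
  refine ⟨fun N => ∃ K : ModuleCat.{u} R, IsTotallyReflexive R C K ∧
    Nonempty (N ≃ₗ[R] (K →ₗ[R] C)), ⟨?_, ?_⟩, ModuleCat.of R K, hK, ⟨.refl R _⟩⟩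
  · rintro N ⟨K, hK, ⟨e⟩⟩ ι
    have := hK.finite
    have := hC.finite
    have : Module.Finite R (K →ₗ[R] C) := inferInstance
    exact (hK.dual_orthogonal.finsupp_right ι).of_equiv_left e
  · rintro N ⟨K, hK, ⟨e⟩⟩
    obtain ⟨t, ht⟩ := hK.finite.fg_top
    have hp : Function.Surjective (Finsupp.linearCombination R ((↑) : t → K)) := by
      rw [← LinearMap.range_eq_top, Finsupp.range_linearCombination, Subtype.range_coe]
      exact ht
    have hL := hK.syzygy hC hp
    have hd := (IsShortExact.subtype hp).lcomp (T := C) (hK.orthogonal 1 le_rfl)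
    exact ⟨t, ModuleCat.of R (LinearMap.ker (Finsupp.linearCombination R ((↑) : t → K)) →ₗ[R] C),
      _, _, ⟨ModuleCat.of R _, hL, ⟨.refl R _⟩⟩, hd.congr e (dualFreeEquiv R C t) (.refl R _)⟩

lemma IsSemidualizing.isSumGProjective_ring [IsNoetherianRing R] (hC : IsSemidualizing R C) :
    IsSumGProjective R C R := by
  obtain ⟨e⟩ := hC.end_equiv
  exact (hC.isTotallyReflexive.isSumGProjective_dual hC).of_equiv e

end Semidualizing

/-! ### Frobenius forms and change of rings -/

/-- A linear form `ε : S → C` such that every `R`-linear map `S → C` is `u ↦ ε (u * s)` for a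
unique `s`; equivalently `s ↦ ε (- * s)` is an isomorphism `S ≅ Hom_R(S, C)` of `S`-modules. -/
structure IsFrobeniusForm {R S C : Type*} [CommRing R] [CommRing S] [Algebra R S] [AddCommGroup C]
    [Module R C] (ε : S →ₗ[R] C) : Prop where
  eq_zero : ∀ s : S, (∀ u, ε (u * s) = 0) → s = 0
  exists_mul : ∀ φ : S →ₗ[R] C, ∃ s : S, ∀ u, φ u = ε (u * s)

namespace IsFrobeniusForm

variable {R S C : Type*} [CommRing R] [CommRing S] [Algebra R S] [AddCommGroup C] [Module R C]
  {ε : S →ₗ[R] C} {N : Type*} [AddCommGroup N] [Module S N]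

/-- Injectivity of `Hom_S(N, S^(ι)) → Hom_R(N, C^(ι))`, `ψ ↦ ε ∘ ψ`. -/
lemma eq_of_mapRange_eq (hε : IsFrobeniusForm ε) {ι : Type*} {ψ χ : N →ₗ[S] (ι →₀ S)}
    (h : ∀ x, Finsupp.mapRange.linearMap (α := ι) ε (ψ x) = Finsupp.mapRange.linearMap ε (χ x)) :
    ψ = χ := by
  ext x i
  rw [← sub_eq_zero]
  refine hε.eq_zero _ fun u => ?_
  have := DFunLike.congr_fun (h (u • x)) i
  rw [mul_sub, map_sub, sub_eq_zero]
  simpa using this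

/-- Over a module-finite algebra, composition with a Frobenius form is a bijection
`Hom_S(N, S^(ι)) → Hom_R(N, C^(ι))`; this is its surjectivity. -/
lemma exists_lift [Module R N] [IsScalarTower R S N] [Module.Finite R S] (hε : IsFrobeniusForm ε)
    {ι : Type*} (φ : N →ₗ[R] (ι →₀ C)) :
    ∃ ψ : N →ₗ[S] (ι →₀ S), ∀ x, Finsupp.mapRange.linearMap ε (ψ x) = φ x := by
  have hx : ∀ x : N, ∃ y : ι →₀ S, ∀ u i, ε (u * y i) = φ (u • x) i := by
    intro x
    obtain ⟨t, ht⟩ := exists_finset_support (φ ∘ₗ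
      (LinearMap.toSpanSingleton S N x).restrictScalars R)
    choose s hs using fun i => hε.exists_mul (Finsupp.lapply i ∘ₗ φ ∘ₗ
      (LinearMap.toSpanSingleton S N x).restrictScalars R)
    refine ⟨Finsupp.onFinset t s fun i hi => ?_, fun u i => (hs i u).symm⟩
    by_contra hit
    refine hi (hε.eq_zero _ fun u => ?_)
    rw [← hs i u]
    by_contra hne
    exact hit (ht u i hne)
  choose y hy using hx
  have huniq : ∀ z w : ι →₀ S, (∀ u i, ε (u * z i) = ε (u * w i)) → z = w := by
    intro z w h
    ext i
    rw [← sub_eq_zero]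
    refine hε.eq_zero _ fun u => ?_
    rw [mul_sub, map_sub, h, sub_self]
  refine ⟨{ toFun := y, map_add' := fun a b => huniq _ _ fun u i => ?_,
            map_smul' := fun s a => huniq _ _ fun u i => ?_ }, fun x => ?_⟩
  · rw [hy, Finsupp.add_apply, mul_add, map_add, hy, hy, smul_add, map_add, Finsupp.add_apply]
  · rw [hy, RingHom.id_apply, Finsupp.smul_apply, smul_eq_mul, ← mul_assoc, hy, mul_smul]
  · ext i
    simpa using hy x 1 i

end IsFrobeniusForm

section ChangeOfRings

variable {R S C : Type u} [CommRing R] [CommRing S] [Algebra R S] [Module.Finite R S]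
  [AddCommGroup C] [Module R C] {ε : S →ₗ[R] C}

/-- `Ext_S^i(N, S^(ι))` vanishes if and only if `Ext_R^i(N, C^(ι))` does, for `i ≥ 1`. -/
lemma IsFrobeniusForm.extVanishes_iff (hε : IsFrobeniusForm ε) (hS : SumOrthogonal R C S)
    (ι : Type u) (n : ℕ) : ∀ (N : Type u) [AddCommGroup N] [Module R N] [Module S N]
      [IsScalarTower R S N],
      ExtVanishes S (n + 1) N (ι →₀ S) ↔ ExtVanishes R (n + 1) N (ι →₀ C) := by
  induction n with
  | zero =>
    intro N _ _ _ _
    have hs := IsShortExact.subtype (Finsupp.linearCombination_id_surjective S N)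
    constructor
    · intro h
      refine (hs.restrictScalars (R := R)).extVanishes_one_right
        ((hS ι).finsupp_left N 1 le_rfl) fun φ => ?_
      obtain ⟨ψ, hψ⟩ := hε.exists_lift
        (N := LinearMap.ker (Finsupp.linearCombination S (id : N → N))) φ
      obtain ⟨χ, hχ⟩ := hs.exists_extend h ψ
      refine ⟨Finsupp.mapRange.linearMap ε ∘ₗ χ.restrictScalars R, fun a => ?_⟩
      rw [← hψ, ← hχ]
      rfl
    · intro h
      refine hs.extVanishes_one_right (ExtOrthogonal.of_projective 1 le_rfl) fun φ => ?_
      obtain ⟨χ, hχ⟩ := (hs.restrictScalars (R := R)).exists_extend h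
        (Finsupp.mapRange.linearMap ε ∘ₗ φ.restrictScalars R)
      obtain ⟨ψ, hψ⟩ := hε.exists_lift χ
      refine ⟨ψ, LinearMap.congr_fun (f := ψ ∘ₗ Submodule.subtype _) (hε.eq_of_mapRange_eq
        (N := LinearMap.ker (Finsupp.linearCombination S (id : N → N))) fun x => ?_)⟩
      exact (hψ _).trans (hχ x)
  | succ n ih =>
    intro N _ _ _ _
    have hs := IsShortExact.subtype (Finsupp.linearCombination_id_surjective S N)
    constructor
    · intro h
      exact (hs.restrictScalars (R := R)).extVanishes_right
        ((ih _).1 (hs.extVanishes_left (ExtOrthogonal.of_projective _ (by lia)) h))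
        ((hS ι).finsupp_left N _ (by lia))
    · intro h
      exact hs.extVanishes_right ((ih _).2 ((hs.restrictScalars (R := R)).extVanishes_left
        ((hS ι).finsupp_left N _ (by lia)) h)) (ExtOrthogonal.of_projective _ (by lia))

lemma IsFrobeniusForm.sumOrthogonal_iff (hε : IsFrobeniusForm ε) (hS : SumOrthogonal R C S)
    (N : Type u) [AddCommGroup N] [Module R N] [Module S N] [IsScalarTower R S N] :
    SumOrthogonal S S N ↔ SumOrthogonal R C N := by
  refine forall_congr' fun ι => forall₂_congr fun i hi => ?_
  obtain ⟨n, rfl⟩ := Nat.exists_eq_add_of_le' hi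
  exact hε.extVanishes_iff hS ι n N

/-- If `φ : N → D` lifts to `ψ : N → B` along a surjection `ε : B → D`, then the cokernel of `ψ`
is an extension of the cokernel of `φ` by the kernel of `ε`. -/
lemma IsShortExact.exists_cokernel_lift {R : Type*} [CommRing R] {A B D N K L : Type*}
    [AddCommGroup A] [Module R A] [AddCommGroup B] [Module R B] [AddCommGroup D] [Module R D]
    [AddCommGroup N] [Module R N] [AddCommGroup K] [Module R K] [AddCommGroup L] [Module R L]
    {σ : A →ₗ[R] B} {ε : B →ₗ[R] D} {φ : N →ₗ[R] D} {π : D →ₗ[R] L} {ψ : N →ₗ[R] B}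
    {q : B →ₗ[R] K} (hε : IsShortExact σ ε) (hφ : IsShortExact φ π) (hψ : IsShortExact ψ q)
    (h : ∀ x, ε (ψ x) = φ x) : ∃ (k : A →ₗ[R] K) (l : K →ₗ[R] L), IsShortExact k l := by
  obtain ⟨l, hl⟩ := hψ.exists_factor (π ∘ₗ ε) fun x => by
    rw [LinearMap.comp_apply, h, hφ.exact.apply_apply_eq_zero]
  refine ⟨q ∘ₗ σ, l, (injective_iff_map_eq_zero _).2 fun a ha => ?_, fun y => ⟨fun hy => ?_, ?_⟩,
    fun z => ?_⟩
  · obtain ⟨x, hx⟩ := (hψ.exact _).1 ha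
    have h0 : φ x = 0 := by rw [← h, hx, hε.exact.apply_apply_eq_zero]
    rw [map_eq_zero_iff φ hφ.injective] at h0
    rw [h0, map_zero] at hx
    exact (map_eq_zero_iff σ hε.injective).1 hx.symm
  · obtain ⟨b, rfl⟩ := hψ.surjective y
    rw [hl] at hy
    obtain ⟨x, hx⟩ := (hφ.exact _).1 hy
    obtain ⟨a, ha⟩ := (hε.exact (b - ψ x)).1 (by rw [map_sub, h, hx, sub_self])
    refine ⟨a, ?_⟩
    rw [LinearMap.comp_apply, ha, map_sub, hψ.exact.apply_apply_eq_zero, sub_zero]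
  · rintro ⟨a, rfl⟩
    rw [LinearMap.comp_apply, hl, LinearMap.comp_apply, hε.exact.apply_apply_eq_zero, map_zero]
  · obtain ⟨b, hb⟩ := (hφ.surjective.comp hε.surjective) z
    exact ⟨q b, (hl b).trans hb⟩

/-- Lifting an embedding `N → C^(ι)` along the Frobenius form embeds `N` into `S^(ι)`, and the
cokernel is, over `R`, an extension of the cokernel of the first embedding by `R^(ι)`. -/
lemma IsFrobeniusForm.isSumGProjective_of_base (hε : IsFrobeniusForm ε) {σ : R →ₗ[R] S}
    (hσ : IsShortExact σ ε) (hR : IsSumGProjective R C R) (hS : SumOrthogonal R C S)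
    (N : Type u) [AddCommGroup N] [Module R N] [Module S N] [IsScalarTower R S N]
    (h : IsSumGProjective R C N) : IsSumGProjective S S N := by
  refine ⟨fun L => ∃ _ : Module R L, IsScalarTower R S L ∧ IsSumGProjective R C L, ⟨?_, ?_⟩,
    inferInstanceAs (Module R N), inferInstanceAs (IsScalarTower R S N), h⟩
  · rintro L ⟨_, _, hL⟩
    exact (hε.sumOrthogonal_iff hS L).2 hL.orthogonal
  · rintro L ⟨_, _, hL⟩
    obtain ⟨ι, L', φ, π, hL', hφ⟩ := hL.coresolve
    obtain ⟨ψ, hψ⟩ := hε.exists_lift φ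
    have hinj : Function.Injective ψ := fun x y hxy =>
      hφ.injective (by rw [← hψ, ← hψ, hxy])
    have hq := IsShortExact.mkQ hinj
    obtain ⟨k, l, hkl⟩ := (hσ.finsupp ι).exists_cokernel_lift hφ (hq.restrictScalars (R := R)) hψ
    exact ⟨ι, ModuleCat.of S ((ι →₀ S) ⧸ LinearMap.range ψ), ψ, _,
      ⟨inferInstanceAs (Module R ((ι →₀ S) ⧸ LinearMap.range ψ)),
        inferInstanceAs (IsScalarTower R S ((ι →₀ S) ⧸ LinearMap.range ψ)),
        (hR.finsupp ι).extension hkl hL'⟩, hq⟩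

/-- A coresolution by free `S`-modules is a coresolution by relative Gorenstein projective
`R`-modules. -/
lemma IsFrobeniusForm.isSumGProjective_base (hε : IsFrobeniusForm ε)
    (hS : IsSumGProjective R C S) (N : Type u) [AddCommGroup N] [Module R N] [Module S N]
    [IsScalarTower R S N] (h : IsSumGProjective S S N) : IsSumGProjective R C N := by
  refine IsSumGProjective.of_coresolution (M := ModuleCat.of R N)
    (fun L => ∃ _ : Module S L, IsScalarTower R S L ∧ IsSumGProjective S S L) ?_ ?_
    ⟨inferInstanceAs (Module S N), inferInstanceAs (IsScalarTower R S N), h⟩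
  · rintro L ⟨_, _, hL⟩
    exact (hε.sumOrthogonal_iff hS.orthogonal L).1 hL.orthogonal
  · rintro L ⟨_, _, hL⟩
    obtain ⟨ι, L', f, g, hL', hfg⟩ := hL.coresolve
    let : Module R L' := Module.compHom L' (algebraMap R S)
    have : IsScalarTower R S L' := IsScalarTower.of_algebraMap_smul fun r x => rfl
    exact ⟨ModuleCat.of R (ι →₀ S), ModuleCat.of R L', f.restrictScalars R, g.restrictScalars R,
      hS.finsupp ι, ⟨inferInstanceAs (Module S L'), inferInstanceAs (IsScalarTower R S L'), hL'⟩,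
      hfg.restrictScalars⟩

end ChangeOfRings

section Retract

variable {R S C : Type u} [CommRing R] [CommRing S] [Algebra R S] {g : S →+* R}
  [AddCommGroup C] [Module R C]

lemma IsRetractTriple.apply_algebraMap (h : IsRetractTriple R S g C) (r : R) :
    g (algebraMap R S r) = r :=
  RingHom.congr_fun h.retract r

/-- As an `R`-module, `S` is the direct sum of `R` and `C ≅ ker g`; `j` and `p` are the inclusion of
`C` and the projection onto it. -/
lemma IsRetractTriple.exists_projection (h : IsRetractTriple R S g C) :
    ∃ (j : C →ₗ[R] S) (p : S →ₗ[R] C), (∀ c, p (j c) = c) ∧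
      (∀ r, p (algebraMap R S r) = 0) ∧ ∀ s, s = algebraMap R S (g s) + j (p s) := by
  obtain ⟨κ⟩ := h.ker_equiv
  let q : S →ₗ[R] RingHom.ker g :=
    { toFun := fun s => ⟨s - algebraMap R S (g s), by
        rw [RingHom.mem_ker, map_sub, h.apply_algebraMap, sub_self]⟩
      map_add' := fun a b => Subtype.ext (by
        change a + b - algebraMap R S (g (a + b)) =
          (a - algebraMap R S (g a)) + (b - algebraMap R S (g b))
        rw [map_add, map_add]; ring)
      map_smul' := fun r a => Subtype.ext (by
        change r • a - algebraMap R S (g (r • a)) = r • (a - algebraMap R S (g a))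
        rw [Algebra.smul_def, map_mul, h.apply_algebraMap, map_mul, Algebra.smul_def]; ring) }
  let j : C →ₗ[R] S :=
    { toFun := fun c => (κ c : S)
      map_add' := fun a b => by rw [map_add]; rfl
      map_smul' := fun r a => by
        rw [map_smul]; rfl }
  refine ⟨j, κ.symm.toLinearMap ∘ₗ q, fun c => ?_, fun r => ?_, fun s => ?_⟩
  · have : q (j c) = κ c := Subtype.ext (by
      change (κ c : S) - algebraMap R S (g (κ c : S)) = κ c
      rw [(RingHom.mem_ker).1 (κ c).2, map_zero, sub_zero])
    simp [this]
  · have : q (algebraMap R S r) = 0 := Subtype.ext (by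
      change algebraMap R S r - algebraMap R S (g (algebraMap R S r)) = 0
      rw [h.apply_algebraMap, sub_self])
    simp [this]
  · change s = algebraMap R S (g s) + (κ (κ.symm (q s)) : S)
    rw [κ.apply_symm_apply]
    change s = algebraMap R S (g s) + (s - algebraMap R S (g s))
    ring

lemma IsRetractTriple.finite (hC : Module.Finite R C) (h : IsRetractTriple R S g C) :
    Module.Finite R S := by
  obtain ⟨j, p, -, -, hs⟩ := h.exists_projection
  refine Module.Finite.of_surjective ((Algebra.linearMap R S).coprod j) fun s => ⟨(g s, p s), ?_⟩
  exact (hs s).symm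

/-- The image `ε` of `1` under `S ≅ Hom_R(S, C)` is a Frobenius form. It is onto because every
`c : C` is the value at `1` of the `R`-linear map `s ↦ g s • c`, which has the form `ε (- * t)`. Its
kernel is the set of `s` for which `ε (- * s)` vanishes on `R`, hence factors through
`S / R ≅ C`; since `Hom_R(C, C) = R`, it is free of rank one over `R`, generated by the
`t` for which `ε (- * t)` is the projection `S → C`. -/
lemma IsRetractTriple.exists_frobeniusForm (hC : IsSemidualizing R C)
    (h : IsRetractTriple R S g C) : ∃ (ε : S →ₗ[R] C) (σ : R →ₗ[R] S),
      IsFrobeniusForm ε ∧ IsShortExact σ ε := by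
  obtain ⟨e, he⟩ := h.hom_equiv
  have hmul : ∀ s u, e s u = e 1 (u * s) := fun s u => by
    rw [mul_comm, ← he, mul_one]
  have hε : IsFrobeniusForm (e 1) := by
    refine ⟨fun s hs => ?_, fun φ => ⟨e.symm φ, fun u => ?_⟩⟩
    · rw [← e.map_eq_zero_iff]
      ext u
      rw [hmul, hs, LinearMap.zero_apply]
    · rw [← hmul, e.apply_symm_apply]
  obtain ⟨j, p, hpj, hpR, hdec⟩ := h.exists_projection
  obtain ⟨t, ht⟩ := hε.exists_mul p
  have hrt : ∀ (r : R) u, e 1 (u * (r • t)) = r • p u := fun r u => by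
    rw [mul_smul_comm, map_smul, ← ht]
  refine ⟨e 1, LinearMap.toSpanSingleton R S t, hε,
    (injective_iff_map_eq_zero _).2 fun r hr => ?_, fun s => ⟨fun hs => ?_, ?_⟩, fun c => ?_⟩
  · refine hC.eq_zero_of_smul fun c => ?_
    rw [← hpj c, ← hrt]
    rw [LinearMap.toSpanSingleton_apply] at hr
    rw [hr, mul_zero, map_zero]
  · obtain ⟨r, hr⟩ := hC.exists_smul (e s ∘ₗ j)
    refine ⟨r, ?_⟩
    rw [LinearMap.toSpanSingleton_apply, ← sub_eq_zero]
    refine hε.eq_zero _ fun u => ?_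
    have hsr : e 1 (algebraMap R S (g u) * s) = 0 := by
      rw [← Algebra.smul_def, map_smul, hs, smul_zero]
    have hsj : e 1 (j (p u) * s) = r • p u := by
      rw [← hmul]
      exact hr (p u)
    have hus : e 1 (u * s) = r • p u := by
      conv_lhs => rw [hdec u]
      rw [add_mul, map_add, hsr, hsj, zero_add]
    rw [mul_sub, map_sub, hrt, hus, sub_self]
  · rintro ⟨r, rfl⟩
    have := hrt r 1
    rw [one_mul, ← map_one (algebraMap R S), hpR, smul_zero, map_one] at this
    exact this
  · obtain ⟨s, hs⟩ := hε.exists_mul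
      ((LinearMap.toSpanSingleton R C c) ∘ₗ
        ({ toFun := g, map_add' := map_add g, map_smul' := fun r x => by
            rw [Algebra.smul_def, map_mul, h.apply_algebraMap]; rfl } : S →ₗ[R] R))
    refine ⟨s, ?_⟩
    have := hs 1
    rw [one_mul] at this
    rw [← this]
    simp

/-- For an `S`-module, being Gorenstein projective over `S` and being `C`-Gorenstein projective
over `R` are the same. -/
theorem IsRetractTriple.isCGorensteinProjective_iff [IsNoetherianRing R]
    (hC : IsSemidualizing R C) (h : IsRetractTriple R S g C) (N : Type u) [AddCommGroup N]
    [Module R N] [Module S N] [IsScalarTower R S N] :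
    IsCGorensteinProjective R C N ↔ IsGorensteinProjective S N := by
  have hCC := hC.sumOrthogonal
  rw [_root_.isCGorensteinProjective_iff hCC, isGorensteinProjective_iff]
  have := h.finite hC.finite
  obtain ⟨ε, σ, hε, hσ⟩ := h.exists_frobeniusForm hC
  have hR := hC.isSumGProjective_ring
  have hS : IsSumGProjective R C S := hR.extension hσ
    ((IsSumGProjective.finsupp_self hCC PUnit).of_equiv
      (Finsupp.uniqueLinearEquiv R C PUnit.unit).symm)
  exact ⟨hε.isSumGProjective_of_base hσ hR hS.orthogonal N, hε.isSumGProjective_base hS N⟩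

end Retract

theorem proposition3p17 {R S : Type u} [CommRing R] [IsNoetherianRing R] [CommRing S]
    [Algebra R S] (g : S →+* R) (C : Type u) [AddCommGroup C] [Module R C]
    (hC : IsSemidualizing R C) (h : IsRetractTriple R S g C)
    (M : Type u) [AddCommGroup M] [Module R M] :
    IsCGorensteinProjective R C M ↔
      IsGorensteinProjective S ((ModuleCat.restrictScalars g).obj (ModuleCat.of R M)) := by
  let N := (ModuleCat.restrictScalars g).obj (ModuleCat.of R M)
  let : Module R N := inferInstanceAs (Module R M)
  have : IsScalarTower R S N := IsScalarTower.of_algebraMap_smul fun r x => by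
    change g (algebraMap R S r) • (show M from x) = r • (show M from x)
    rw [h.apply_algebraMap]
  exact h.isCGorensteinProjective_iff hC N
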